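/- Let $K_0$ be a formally real field, let $t\ge 1$, let $X_1,\dots,X_t$ be algebraically independent indeterminates over $K_0$, and put $K=K_0(X_1,\dots,X_t)$. For an algebra $A$ with scalar involution $\overline{\phantom{x}}$ over a field and a scalar $\gamma\neq 0$, the Cayley–Dickson process yields the algebra $(A,\gamma)=A\oplus A$ with $$(a_1,a_2)(b_1,b_2)=(a_1b_1+\gamma\,\overline{b_2}\,a_2,\ a_2\overline{b_1}+b_2a_1),\qquad \overline{(a_1,a_2)}=(\overline{a_1},-a_2),$$ and the norm form of an algebra $A$ with scalar involution is the quadratic form $n_C^{A}$ given by $a\overline{a}=n_C^{A}(a)\cdot 1$. Let $A_t=\left(\frac{X_1,\dots,X_t}{K}\right)$ be the $2^t$-dimensional $K$-algebra obtained from $K$ (with the identity as involution) by applying this process $t$ times with the parameters $X_1,\dots,X_t$ in this order, and let $$T_P=\langle X_1,X_2,-X_1X_2,X_3,\dots,(-1)^{t+1}X_1\cdots X_t\rangle$$ be its pure trace form, the diagonal form with one coefficient $(-1)^{|S|+1}\prod_{i\in S}X_i$ for every nonempty $S\subseteq\{1,\dots,t\}$. Let $n\ge 1$ be an integer and write $n=2^k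 r$ with $k\ge 0$ and $r$ odd. Let $K'_n=K\big((2^k+1)\times\langle 1\rangle\perp(n-1)\times T_P\big)$ be the function field over $K$ of the form $\varphi'_n=(2^k+1)\times\langle 1\rangle\perp(n-1)\times T_P$, that is, the quotient field of $K[Y_1,\dots,Y_d]/(\varphi'_n(Y_1,\dots,Y_d))$ with $d=\dim\varphi'_n$. Let $A'_t(n)=A_t\otimes_K K'_n$, with the involution of $A_t$ extended $K'_n$-linearly. **Proposition 2.8.** The norm form $n_C^{A'_t(n)}$ is anisotropic over $K'_n$: if $x\in A'_t(n)$ and $n_C^{A'_t(n)}(x)=0$, then $x=0$. -/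

import Mathlib

universe u

open scoped TensorProduct

/-- A finite-dimensional unital (not necessarily associative) `K`-algebra together with a
scalar involution `conj`. -/
structure ScalarInvolutionAlgebra (K : Type u) [Field K] where
  carrier : Type u
  [ring : NonAssocRing carrier]
  [nontrivial : Nontrivial carrier]
  [module : Module K carrier]
  [isScalarTower : IsScalarTower K carrier carrier]
  [smulCommClass : SMulCommClass K carrier carrier]
  [finite : Module.Finite K carrier]
  conj : carrier →ₗ[K] carrier
  conj_mul : ∀ a b : carrier, conj (a * b) = conj b * conj a
  conj_conj : ∀ a : carrier, conj (conj a) = a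
  add_conj : ∀ a : carrier, ∃ c : K, a + conj a = c • (1 : carrier)
  mul_conj : ∀ a : carrier, ∃ c : K, a * conj a = c • (1 : carrier)

namespace ScalarInvolutionAlgebra

attribute [instance] ring nontrivial module isScalarTower smulCommClass finite

variable {K : Type u} [Field K]

theorem smul_one_injective (A : ScalarInvolutionAlgebra K) {c d : K}
    (h : c • (1 : A.carrier) = d • (1 : A.carrier)) : c = d :=
  smul_left_injective K (one_ne_zero : (1 : A.carrier) ≠ 0) h

/-- The scalar `n(a)` determined by `a * conj a = n(a) • 1`. -/
noncomputable def normFun (A : ScalarInvolutionAlgebra K) (a : A.carrier) : K :=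
  (A.mul_conj a).choose

theorem mul_conj_eq (A : ScalarInvolutionAlgebra K) (a : A.carrier) :
    a * A.conj a = A.normFun a • (1 : A.carrier) :=
  (A.mul_conj a).choose_spec

/-- The scalar `t(a)` determined by `a + conj a = t(a) • 1`. -/
noncomputable def traceFun (A : ScalarInvolutionAlgebra K) (a : A.carrier) : K :=
  (A.add_conj a).choose

theorem add_conj_eq (A : ScalarInvolutionAlgebra K) (a : A.carrier) :
    a + A.conj a = A.traceFun a • (1 : A.carrier) :=
  (A.add_conj a).choose_spec

theorem polar_eq (A : ScalarInvolutionAlgebra K) (a b : A.carrier) :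
    a * A.conj b + b * A.conj a = A.traceFun (a * A.conj b) • (1 : A.carrier) := by
  rw [← A.add_conj_eq, A.conj_mul, A.conj_conj]

/-- The norm form `n(a) = a * conj a` of an algebra with scalar involution, as a quadratic
form over the base field. -/
noncomputable def norm (A : ScalarInvolutionAlgebra K) : QuadraticForm K A.carrier where
  toFun := A.normFun
  toFun_smul c a := A.smul_one_injective (by
    rw [← A.mul_conj_eq, map_smul, smul_mul_smul_comm, A.mul_conj_eq, smul_smul, smul_eq_mul])
  exists_companion' :=
    ⟨LinearMap.mk₂ K (fun a b => A.traceFun (a * A.conj b))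
      (fun a a' b => A.smul_one_injective (by
        rw [← A.polar_eq, add_smul, ← A.polar_eq, ← A.polar_eq, map_add, add_mul, mul_add]
        abel))
      (fun c a b => A.smul_one_injective (by
        rw [← A.polar_eq, smul_eq_mul, mul_smul, ← A.polar_eq, map_smul, smul_mul_assoc,
          mul_smul_comm, smul_add]))
      (fun a b b' => A.smul_one_injective (by
        rw [← A.polar_eq, add_smul, ← A.polar_eq, ← A.polar_eq, map_add, add_mul, mul_add]
        abel))
      (fun c a b => A.smul_one_injective (by
        rw [← A.polar_eq, smul_eq_mul, mul_smul, ← A.polar_eq, map_smul, smul_mul_assoc,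
          mul_smul_comm, smul_add])),
      fun a b => A.smul_one_injective (by
        rw [LinearMap.mk₂_apply, add_smul, add_smul, ← A.polar_eq, ← A.mul_conj_eq,
          ← A.mul_conj_eq, ← A.mul_conj_eq, map_add, add_mul, mul_add, mul_add]
        abel)⟩

theorem norm_smul_one (A : ScalarInvolutionAlgebra K) (a : A.carrier) :
    A.norm a • (1 : A.carrier) = a * A.conj a :=
  (A.mul_conj_eq a).symm

/-- The field `K` itself, with the identity as scalar involution. -/
def ofField (K : Type u) [Field K] : ScalarInvolutionAlgebra K where
  carrier := K
  conj := LinearMap.id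
  conj_mul a b := mul_comm a b
  conj_conj _ := rfl
  add_conj a := ⟨a + a, by simp⟩
  mul_conj a := ⟨a * a, by simp⟩

/-- The underlying vector space `A ⊕ A` of the algebra `(A, γ)`. -/
@[ext] structure Double (A : ScalarInvolutionAlgebra K) (γ : K) where
  fst : A.carrier
  snd : A.carrier

namespace Double

variable {A : ScalarInvolutionAlgebra K} {γ : K}

def equivProd (A : ScalarInvolutionAlgebra K) (γ : K) :
    Double A γ ≃ A.carrier × A.carrier where
  toFun x := (x.fst, x.snd)
  invFun x := ⟨x.1, x.2⟩
  left_inv _ := rfl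
  right_inv _ := rfl

instance : AddCommGroup (Double A γ) := (equivProd A γ).addCommGroup

instance : Module K (Double A γ) := (equivProd A γ).module K

instance : Module.Finite K (Double A γ) :=
  Module.Finite.equiv ((equivProd A γ).linearEquiv K).symm

@[simp] theorem fst_zero : (0 : Double A γ).fst = 0 := rfl
@[simp] theorem snd_zero : (0 : Double A γ).snd = 0 := rfl
@[simp] theorem fst_add (x y : Double A γ) : (x + y).fst = x.fst + y.fst := rfl
@[simp] theorem snd_add (x y : Double A γ) : (x + y).snd = x.snd + y.snd := rfl
@[simp] theorem fst_smul (c : K) (x : Double A γ) : (c • x).fst = c • x.fst := rfl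
@[simp] theorem snd_smul (c : K) (x : Double A γ) : (c • x).snd = c • x.snd := rfl

instance : One (Double A γ) := ⟨⟨1, 0⟩⟩

/-- The Cayley–Dickson multiplication. -/
instance : Mul (Double A γ) :=
  ⟨fun a b =>
    ⟨a.fst * b.fst + γ • (A.conj b.snd * a.snd), a.snd * A.conj b.fst + b.snd * a.fst⟩⟩

@[simp] theorem fst_one : (1 : Double A γ).fst = 1 := rfl
@[simp] theorem snd_one : (1 : Double A γ).snd = 0 := rfl
@[simp] theorem fst_mul (a b : Double A γ) :
    (a * b).fst = a.fst * b.fst + γ • (A.conj b.snd * a.snd) := rfl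
@[simp] theorem snd_mul (a b : Double A γ) :
    (a * b).snd = a.snd * A.conj b.fst + b.snd * a.fst := rfl

end Double

@[simp] theorem conj_one (A : ScalarInvolutionAlgebra K) : A.conj 1 = 1 := by
  have h := A.conj_mul (A.conj 1) 1
  simpa [A.conj_conj] using h.symm

namespace Double

variable {A : ScalarInvolutionAlgebra K} {γ : K}

instance : NonAssocRing (Double A γ) where
  left_distrib a b c := by
    ext <;> simp [mul_add, add_mul, smul_add] <;> abel
  right_distrib a b c := by
    ext <;> simp [mul_add, add_mul, smul_add] <;> abel
  zero_mul a := by ext <;> simp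
  mul_zero a := by ext <;> simp
  one_mul a := by ext <;> simp
  mul_one a := by ext <;> simp

instance : Nontrivial (Double A γ) :=
  ⟨⟨0, 1, fun h => zero_ne_one (congrArg Double.fst h)⟩⟩

instance : IsScalarTower K (Double A γ) (Double A γ) :=
  ⟨fun c a b => by
    ext <;> simp [smul_add, smul_mul_assoc, mul_smul_comm, smul_comm c γ]⟩

instance : SMulCommClass K (Double A γ) (Double A γ) :=
  ⟨fun c a b => by
    ext <;> simp [smul_add, smul_mul_assoc, mul_smul_comm, smul_comm c γ]⟩

/-- The involution `(a₁, a₂) ↦ (conj a₁, -a₂)`. -/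
def conj (A : ScalarInvolutionAlgebra K) (γ : K) : Double A γ →ₗ[K] Double A γ where
  toFun a := ⟨A.conj a.fst, -a.snd⟩
  map_add' a b := by ext <;> simp [add_comm]
  map_smul' c a := by ext <;> simp

end Double

/-- The algebra `(A, γ)` obtained from `A` by the Cayley–Dickson process. -/
def double (A : ScalarInvolutionAlgebra K) (γ : K) : ScalarInvolutionAlgebra K where
  carrier := Double A γ
  conj := Double.conj A γ
  conj_mul a b := by
    ext <;> simp [Double.conj, A.conj_mul, A.conj_conj, add_comm]
  conj_conj a := by ext <;> simp [Double.conj, A.conj_conj]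
  add_conj a := ⟨A.traceFun a.fst, by ext <;> simp [Double.conj, A.add_conj_eq]⟩
  mul_conj a := ⟨A.normFun a.fst - γ * A.normFun (A.conj a.snd), by
    have h := A.mul_conj_eq (A.conj a.snd)
    rw [A.conj_conj] at h
    ext
    · rw [Double.fst_smul, Double.fst_one, sub_smul, mul_smul, ← h, ← A.mul_conj_eq]
      simp [Double.conj, sub_eq_add_neg]
    · simp [Double.conj, A.conj_conj]⟩

/-- The algebra `(α₁, …, α_t / K)` obtained from `K` by applying the Cayley–Dickson process
`t` times, with the parameters `α₁, …, α_t` in this order. -/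
def process : (t : ℕ) → (Fin t → K) → ScalarInvolutionAlgebra K
  | 0, _ => ofField K
  | t + 1, α => (process t fun i => α i.castSucc).double (α (Fin.last t))

section BaseChange

variable (A : ScalarInvolutionAlgebra K) (L : Type u) [Field L] [Algebra K L]

theorem conj_mul_baseChange (a b : L ⊗[K] A.carrier) :
    A.conj.baseChange L (a * b) = A.conj.baseChange L b * A.conj.baseChange L a := by
  induction a with
  | zero => simp
  | add a a' ha ha' => simp [add_mul, mul_add, ha, ha']
  | tmul l a =>
    induction b with
    | zero => simp
    | add b b' hb hb' => simp [add_mul, mul_add, hb, hb']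
    | tmul m b => simp [A.conj_mul, mul_comm]

theorem conj_conj_baseChange (a : L ⊗[K] A.carrier) :
    A.conj.baseChange L (A.conj.baseChange L a) = a := by
  induction a with
  | zero => simp
  | add a a' ha ha' => simp [ha, ha']
  | tmul l a => simp [A.conj_conj]

theorem exists_add_conj_baseChange (a : L ⊗[K] A.carrier) :
    ∃ c : L, a + A.conj.baseChange L a = c • (1 : L ⊗[K] A.carrier) := by
  induction a with
  | zero => exact ⟨0, by simp⟩
  | tmul l a =>
    refine ⟨l * algebraMap K L (A.traceFun a), ?_⟩
    rw [LinearMap.baseChange_tmul, ← TensorProduct.tmul_add, A.add_conj_eq,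
      TensorProduct.tmul_smul, Algebra.TensorProduct.one_def, TensorProduct.smul_tmul',
      TensorProduct.smul_tmul', smul_eq_mul, mul_one, Algebra.smul_def, mul_comm]
  | add a b ha hb =>
    obtain ⟨c, hc⟩ := ha
    obtain ⟨d, hd⟩ := hb
    refine ⟨c + d, ?_⟩
    rw [map_add, add_smul, ← hc, ← hd]
    abel

end BaseChange

/-- Extension of scalars `L ⊗ A`, with the involution `id ⊗ conj`. -/
noncomputable def baseChange (A : ScalarInvolutionAlgebra K) (L : Type u) [Field L]
    [Algebra K L] : ScalarInvolutionAlgebra L where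
  carrier := L ⊗[K] A.carrier
  nontrivial := inferInstance
  conj := A.conj.baseChange L
  conj_mul := conj_mul_baseChange A L
  conj_conj := conj_conj_baseChange A L
  add_conj a := exists_add_conj_baseChange A L a
  mul_conj a := by
    induction a with
    | zero => exact ⟨0, by simp⟩
    | tmul l a =>
      refine ⟨l * l * algebraMap K L (A.normFun a), ?_⟩
      rw [LinearMap.baseChange_tmul, Algebra.TensorProduct.tmul_mul_tmul, A.mul_conj_eq,
        TensorProduct.tmul_smul, Algebra.TensorProduct.one_def, TensorProduct.smul_tmul',
        TensorProduct.smul_tmul', smul_eq_mul, mul_one, Algebra.smul_def, mul_comm]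
    | add a b ha hb =>
      obtain ⟨c, hc⟩ := ha
      obtain ⟨d, hd⟩ := hb
      obtain ⟨e, he⟩ := exists_add_conj_baseChange A L (a * A.conj.baseChange L b)
      rw [conj_mul_baseChange, conj_conj_baseChange] at he
      refine ⟨c + d + e, ?_⟩
      rw [map_add, add_mul, mul_add, mul_add, add_smul, add_smul, ← hc, ← hd, ← he]
      abel

end ScalarInvolutionAlgebra

/-- The quadratic polynomial `∑ aᵢ Xᵢ²` of the diagonal form `⟨aᵢ⟩`, `i : ι`. -/
noncomputable def diagonalPolynomial {K : Type u} [Field K] {ι : Type} [Fintype ι] (a : ι → K) :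
    MvPolynomial ι K :=
  ∑ i, MvPolynomial.C (a i) * MvPolynomial.X i ^ 2

/-- The function field of the diagonal form `⟨aᵢ⟩`: the quotient field of
`K[Xᵢ : i ∈ ι] / (∑ aᵢ Xᵢ²)`. -/
abbrev DiagonalFunctionField {K : Type u} [Field K] {ι : Type} [Fintype ι] (a : ι → K) :
    Type u :=
  FractionRing (MvPolynomial ι K ⧸ Ideal.span {diagonalPolynomial a})

theorem isPrime_span_diagonalPolynomial {K : Type u} [Field K] {ι : Type} [Fintype ι]
    (a : ι → K) {i j : ι} (hij : j ≠ i) (hi : a i = 1) (hj : a j = 1)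
    (hK : ¬ IsSquare (-1 : K)) : (Ideal.span {diagonalPolynomial a}).IsPrime := by
  classical
  let e := (MvPolynomial.renameEquiv K (Equiv.optionSubtypeNe i).symm).trans
    (MvPolynomial.optionEquivLeft K {x // x ≠ i})
  let g : MvPolynomial {x // x ≠ i} K :=
    ∑ x : {x // x ≠ i}, MvPolynomial.C (a x) * MvPolynomial.X x ^ 2
  let p : Polynomial (MvPolynomial {x // x ≠ i} K) := Polynomial.X ^ 2 + Polynomial.C g
  have he : e (diagonalPolynomial a) = p := by
    have h1 : e (MvPolynomial.X i) = Polynomial.X := by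
      simp [e, MvPolynomial.optionEquivLeft_apply]
    have h2 : ∀ x : {x // x ≠ i},
        e (MvPolynomial.X x.1) = Polynomial.C (MvPolynomial.X x) := by
      intro x
      simp [e, MvPolynomial.optionEquivLeft_apply, Equiv.optionSubtypeNe_symm_apply, x.2]
    have h3 : ∀ c : K, e (MvPolynomial.C c) = Polynomial.C (MvPolynomial.C c) := by
      intro c
      simp [e, MvPolynomial.optionEquivLeft_apply]
    have h4 : diagonalPolynomial a = MvPolynomial.X i ^ 2 +
        ∑ x : {x // x ≠ i}, MvPolynomial.C (a x) * MvPolynomial.X x.1 ^ 2 := by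
      rw [diagonalPolynomial, Fintype.sum_eq_add_sum_subtype_ne _ i, hi, map_one, one_mul]
    rw [h4, map_add, map_pow, h1, map_sum]
    simp only [p, g, map_sum, map_mul, map_pow, h2, h3]
  have hd : p.natDegree = 2 := by
    simp only [p]
    compute_degree!
  have hm : p.Monic := by
    simp only [p]
    monicity!
  have hg : ∀ r : MvPolynomial {x // x ≠ i} K, r ^ 2 + g ≠ 0 := by
    intro r hr
    apply hK
    have h := congrArg
      (MvPolynomial.eval fun x : {x // x ≠ i} => if x = ⟨j, hij⟩ then (1 : K) else 0) hr
    simp only [g, map_add, map_pow, map_sum, map_mul, MvPolynomial.eval_C, MvPolynomial.eval_X,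
      ite_pow, one_pow, zero_pow two_ne_zero, mul_ite, mul_one, mul_zero, map_zero,
      Finset.sum_ite_eq', Finset.mem_univ, if_true, hj] at h
    exact ⟨_, by rw [← sq]; exact (eq_neg_of_add_eq_zero_left h).symm⟩
  have hirr : Irreducible p := by
    rw [hm.irreducible_iff_roots_eq_zero_of_degree_le_three (by omega) (by omega)]
    refine Multiset.eq_zero_of_forall_notMem fun r hr => hg r ?_
    simpa [p] using (Polynomial.mem_roots'.1 hr).2
  have hne : diagonalPolynomial a ≠ 0 := fun h => hirr.ne_zero (by rw [← he, h, map_zero])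
  rw [Ideal.span_singleton_prime hne]
  apply Irreducible.prime
  rw [← MulEquiv.irreducible_iff e.toMulEquiv]
  rw [← he] at hirr
  exact hirr

/-- The rational function field `K₀(X₁, …, X_t)`. -/
abbrev RationalField (K₀ : Type u) [Field K₀] (t : ℕ) : Type u :=
  FractionRing (MvPolynomial (Fin t) K₀)

/-- The indeterminates `X₁, …, X_t` of `K₀(X₁, …, X_t)`. -/
noncomputable def indeterminate (K₀ : Type u) [Field K₀] (t : ℕ) (i : Fin t) :
    RationalField K₀ t :=
  algebraMap (MvPolynomial (Fin t) K₀) (RationalField K₀ t) (MvPolynomial.X i)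

theorem not_isSquare_neg_one_rationalField (K₀ : Type u) [Field K₀] [IsFormallyReal K₀] (t : ℕ) :
    ¬ IsSquare (-1 : RationalField K₀ t) := by
  rintro ⟨x, hx⟩
  obtain ⟨y, hy⟩ := IsIntegrallyClosed.exists_algebraMap_eq_of_isIntegral_pow
    (R := MvPolynomial (Fin t) K₀) (x := x) two_pos (by
      rw [sq, ← hx]
      exact isIntegral_one.neg)
  have h : y * y = -1 := by
    apply IsFractionRing.injective (MvPolynomial (Fin t) K₀) (RationalField K₀ t)
    rw [map_mul, hy, map_neg, map_one, hx]
  have h' := congrArg (MvPolynomial.eval (0 : Fin t → K₀)) h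
  rw [map_mul, map_neg, map_one] at h'
  have h1 : IsSumSq (1 : K₀) := by simp
  exact one_ne_zero (IsFormallyReal.eq_zero_of_isSumSq_of_neg_isSumSq h1 (h' ▸ .mul_self _))

/-- The algebra `A_t` of Brown's construction over `K = K₀(X₁, …, X_t)`: the Cayley–Dickson
process with the parameters `X₁, …, X_t`. -/
noncomputable def brownAlgebra (K₀ : Type u) [Field K₀] (t : ℕ) :
    ScalarInvolutionAlgebra (RationalField K₀ t) :=
  ScalarInvolutionAlgebra.process t (indeterminate K₀ t)

/-- The coefficients of the pure trace form
`T_P = ⟨α₁, α₂, -α₁α₂, α₃, …, (-1)^(t+1) α₁⋯α_t⟩` of the algebra `(α₁, …, α_t / K)`: one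
coefficient `(-1)^(|S|+1) ∏_{i ∈ S} αᵢ` for each of the `2^t - 1` nonempty subsets `S` of
`{1, …, t}`. -/
def pureTraceCoeff {K : Type u} [Field K] {t : ℕ} (α : Fin t → K)
    (S : {S : Finset (Fin t) // S.Nonempty}) : K :=
  (-1) ^ (S.1.card + 1) * ∏ i ∈ S.1, α i

/-- The coefficients of the diagonal form `m × ⟨1⟩ ⊥ l × T_P` over `K₀(X₁, …, X_t)`, where `T_P`
is the pure trace form of `A_t`. -/
noncomputable def phiCoeff (K₀ : Type u) [Field K₀] (t m l : ℕ) :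
    Fin m ⊕ (Fin l × {S : Finset (Fin t) // S.Nonempty}) → RationalField K₀ t :=
  Sum.elim (fun _ => 1) fun p => pureTraceCoeff (indeterminate K₀ t) p.2

/-- The form `(2^k + 1) × ⟨1⟩ ⊥ (n - 1) × T_P` is irreducible, so that its function field is
a field. -/
instance isPrime_phi (K₀ : Type u) [Field K₀] [IsFormallyReal K₀] (t n k : ℕ) :
    (Ideal.span {diagonalPolynomial (phiCoeff K₀ t (2 ^ k + 1) (n - 1))}).IsPrime := by
  have hk : 0 < 2 ^ k := by positivity
  exact isPrime_span_diagonalPolynomial _ (i := Sum.inl ⟨0, by omega⟩) (j := Sum.inl ⟨1, by omega⟩)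
    (by simp) rfl rfl (not_isSquare_neg_one_rationalField K₀ t)

/-- The field `K'_n`, the function field of `(2^k + 1) × ⟨1⟩ ⊥ (n - 1) × T_P` over
`K₀(X₁, …, X_t)`. -/
abbrev PhiFunctionField (K₀ : Type u) [Field K₀] (t n k : ℕ) : Type u :=
  DiagonalFunctionField (phiCoeff K₀ t (2 ^ k + 1) (n - 1))

/-- The algebra `A'_t(n) = A_t ⊗_K K'_n`, with its scalar involution. -/
noncomputable def brownAlgebraPhi (K₀ : Type u) [Field K₀] [IsFormallyReal K₀] (t n k : ℕ) :
    ScalarInvolutionAlgebra (PhiFunctionField K₀ t n k) :=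
  (brownAlgebra K₀ t).baseChange (PhiFunctionField K₀ t n k)

/-! The norm form `N` of `A_t` is diagonal, the tensor product of the binary forms `⟨1, -Xᵢ⟩`, and
keeps its coefficients after extension of scalars. Split one `⟨1⟩` off `φ'_n`, so that its
polynomial is `Y² + g` with `g` in the other variables. Clearing denominators turns a zero of `N`
over the function field into a divisibility by `Y² + g`, and reduction modulo `Y² = -g` leaves pairs
`(A, B)` with `∑ cₛ(Aₛ² - g Bₛ²) = 0` and `∑ cₛ Aₛ Bₛ = 0`
(`DiagonalFunctionField.eq_zero_of_sum_mul_sq_eq_zero`). It remains to force `A = B = 0`.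

If `n > 1`, then `g` contains a term `X₁ Yⱼ²` coming from `T_P`. The endomorphism `Xᵢ ↦ -Xᵢ²` of `K`
makes every coefficient of `N` a square and turns this term into `-X₁² Yⱼ²`. As a polynomial in
`Yⱼ`, `-g` then has a square as leading coefficient, so the first equation has a sum of squares as
its top coefficient, and formal reality makes the degrees descend
(`Polynomial.eq_zero_of_sum_sq_sub_mul_sq`).

If `n = 1`, then `φ'_n = ⟨1, 1⟩` and `g = Yⱼ²`. With `z² = -1`, both vectors `A ± z Yⱼ B` are zeros
of `N`. But `N` is anisotropic over `E(X₁, …, X_t)` for every field `E`: the leading exponents of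
its terms differ modulo 2 (`eq_zero_of_sum_normCoeff_mul_sq`). An algebraic closure of `K₀` serves
as `E`. -/

theorem QuadraticMap.apply_eq_sum_of_polar_eq_zero {R M ι : Type*} [CommRing R] [AddCommGroup M]
    [Module R M] [Fintype ι] (Q : QuadraticForm R M) (b : Module.Basis ι R M) {c : ι → R}
    (hc : ∀ i, Q (b i) = c i) (hp : ∀ i j, i ≠ j → polar Q (b i) (b j) = 0) (x : M) :
    Q x = ∑ i, c i * b.equivFun x i ^ 2 := by
  classical
  conv_lhs => rw [← b.sum_equivFun x]
  rw [QuadraticMap.map_sum, Finset.sum_eq_zero (s := Finset.filter _ _), add_zero]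
  · refine Finset.sum_congr rfl fun i _ => ?_
    rw [QuadraticMap.map_smul, hc, smul_eq_mul]
    ring
  · intro p hp'
    induction p with
    | _ i j =>
      have hij : i ≠ j := by simpa using hp'
      rw [Sym2.map_mk, QuadraticMap.polarSym2_sym2Mk, QuadraticMap.polar_smul_left,
        QuadraticMap.polar_smul_right, hp i j hij, smul_zero, smul_zero]

/-! ### Diagonalisation of the norm form. -/

namespace ScalarInvolutionAlgebra

variable {K : Type u} [Field K]

theorem norm_eq_of_mul_conj_eq (A : ScalarInvolutionAlgebra K) {a : A.carrier} {c : K}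
    (h : a * A.conj a = c • (1 : A.carrier)) : A.norm a = c :=
  A.smul_one_injective (by rw [A.norm_smul_one, h])

/-- The conjugate of `a` is a scalar minus `a`, hence commutes with `a`. -/
theorem norm_conj (A : ScalarInvolutionAlgebra K) (a : A.carrier) :
    A.norm (A.conj a) = A.norm a := by
  apply A.norm_eq_of_mul_conj_eq
  have h : A.conj a = A.traceFun a • (1 : A.carrier) - a := by
    rw [← A.add_conj_eq]; abel
  rw [A.conj_conj, A.norm_smul_one, h]
  simp [sub_mul, mul_sub, smul_mul_assoc, mul_smul_comm]

theorem norm_double (A : ScalarInvolutionAlgebra K) (γ : K) (x : Double A γ) :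
    (A.double γ).norm x = A.norm x.fst - γ * A.norm x.snd := by
  apply (A.double γ).norm_eq_of_mul_conj_eq
  rw [← A.norm_conj x.snd]
  have h := A.norm_smul_one (A.conj x.snd)
  rw [A.conj_conj] at h
  change x * Double.conj A γ x = (_ : K) • (1 : Double A γ)
  ext
  · rw [Double.fst_smul, Double.fst_one, sub_smul, mul_smul, h, A.norm_smul_one]
    simp [Double.conj, sub_eq_add_neg]
  · simp [Double.conj, A.conj_conj]

theorem norm_ofField (x : K) : (ofField K).norm x = x ^ 2 := by
  apply (ofField K).norm_eq_of_mul_conj_eq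
  change x * x = x ^ 2 • (1 : K)
  simp [sq]

/-- The coefficient `∏ (-αᵢ)`, over the `i` with `s i = true`, of the norm form of
`(α₁, …, α_t / K)`. -/
def normCoeff {t : ℕ} (α : Fin t → K) (s : Fin t → Bool) : K :=
  ∏ i, if s i then -α i else 1

/-- Coordinates on a Cayley–Dickson double, from coordinates on the algebra. -/
def doubleCoordinates {t : ℕ} (A : ScalarInvolutionAlgebra K) (γ : K)
    (e : A.carrier ≃ₗ[K] ((Fin t → Bool) → K)) :
    Double A γ ≃ₗ[K] ((Fin (t + 1) → Bool) → K) where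
  toFun x s := if s (Fin.last t) then e x.snd (Fin.init s) else e x.fst (Fin.init s)
  map_add' x y := by ext s; by_cases h : s (Fin.last t) <;> simp [h]
  map_smul' c x := by ext s; by_cases h : s (Fin.last t) <;> simp [h]
  invFun f := ⟨e.symm fun s => f (Fin.snoc s false), e.symm fun s => f (Fin.snoc s true)⟩
  left_inv x := by ext <;> simp
  right_inv f := by
    ext s
    cases h : s (Fin.last t) <;> simp [h] <;> congr 1 <;> rw [← h, Fin.snoc_init_self]

/-- The diagonal counterpart of `norm_double`: the last entry of `s` selects the component of `x`,
and `true` contributes the factor `-γ`. -/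
theorem sum_normCoeff_mul_doubleCoordinates_sq {t : ℕ} (A : ScalarInvolutionAlgebra K)
    (α : Fin (t + 1) → K) (e : A.carrier ≃ₗ[K] ((Fin t → Bool) → K))
    (x : Double A (α (Fin.last t))) :
    ∑ s, normCoeff α s * doubleCoordinates A (α (Fin.last t)) e x s ^ 2 =
      ∑ s, normCoeff (fun i => α i.castSucc) s * e x.fst s ^ 2 -
        α (Fin.last t) * ∑ s, normCoeff (fun i => α i.castSucc) s * e x.snd s ^ 2 := by
  have h : ∀ b s, doubleCoordinates A (α (Fin.last t)) e x
      (Fin.snocEquiv (fun _ => Bool) (b, s)) = if b then e x.snd s else e x.fst s := fun b s => by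
    simp [doubleCoordinates, Fin.snocEquiv]
  have hc : ∀ b s, normCoeff α (Fin.snocEquiv (fun _ => Bool) (b, s)) =
      if b then -(α (Fin.last t) * normCoeff (fun i => α i.castSucc) s)
        else normCoeff (fun i => α i.castSucc) s := fun b s => by
    cases b <;> simp [normCoeff, Fin.snocEquiv, Fin.prod_univ_castSucc, mul_comm]
  rw [← (Fin.snocEquiv fun _ => Bool).sum_comp, Fintype.sum_prod_type, Fintype.sum_bool]
  simp only [h, hc, Finset.mul_sum, if_true, Bool.false_eq_true, if_false, neg_mul,
    Finset.sum_neg_distrib, mul_assoc]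
  ring

theorem exists_norm_process_eq_sum (t : ℕ) (α : Fin t → K) :
    ∃ e : (process t α).carrier ≃ₗ[K] ((Fin t → Bool) → K),
      ∀ x, (process t α).norm x = ∑ s, normCoeff α s * e x s ^ 2 := by
  induction t with
  | zero =>
    refine ⟨(LinearEquiv.funUnique (Fin 0 → Bool) K K).symm, fun x => ?_⟩
    refine (norm_ofField (K := K) x).trans ?_
    rw [Fintype.sum_unique, normCoeff, Fin.prod_univ_zero, one_mul]
    rfl
  | succ t ih =>
    obtain ⟨e, he⟩ := ih fun i => α i.castSucc
    refine ⟨doubleCoordinates _ _ e,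
      fun x : Double (process t fun i => α i.castSucc) (α (Fin.last t)) => ?_⟩
    refine (norm_double (process t fun i => α i.castSucc) (α (Fin.last t)) x).trans ?_
    rw [he, he]
    exact (sum_normCoeff_mul_doubleCoordinates_sq _ α e x).symm

theorem norm_baseChange_tmul (A : ScalarInvolutionAlgebra K) (L : Type u) [Field L] [Algebra K L]
    (a : A.carrier) :
    (A.baseChange L).norm (1 ⊗ₜ[K] a : L ⊗[K] A.carrier) = algebraMap K L (A.norm a) := by
  have h : (1 ⊗ₜ[K] a : L ⊗[K] A.carrier) * A.conj.baseChange L (1 ⊗ₜ[K] a) =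
      algebraMap K L (A.norm a) • (1 : L ⊗[K] A.carrier) := by
    rw [LinearMap.baseChange_tmul, Algebra.TensorProduct.tmul_mul_tmul, ← A.norm_smul_one,
      TensorProduct.tmul_smul, Algebra.TensorProduct.one_def, mul_one, algebraMap_smul]
  exact (A.baseChange L).norm_eq_of_mul_conj_eq h

/-- Being diagonal is visible on a basis: it suffices to know the norms of basis vectors and of sums
of two of them, and these are values on pure tensors `1 ⊗ a`. -/
theorem exists_norm_baseChange_eq_sum (A : ScalarInvolutionAlgebra K) {ι : Type*} [Fintype ι]
    (c : ι → K) (e : A.carrier ≃ₗ[K] (ι → K)) (he : ∀ x, A.norm x = ∑ i, c i * e x i ^ 2)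
    (L : Type u) [Field L] [Algebra K L] :
    ∃ e' : (A.baseChange L).carrier ≃ₗ[L] (ι → L),
      ∀ x, (A.baseChange L).norm x = ∑ i, algebraMap K L (c i) * e' x i ^ 2 := by
  classical
  let b : Module.Basis ι K A.carrier := Module.Basis.ofEquivFun e
  let b' : Module.Basis ι L (A.baseChange L).carrier := Algebra.TensorProduct.basis L b
  have hb' : ∀ i, b' i = (1 : L) ⊗ₜ[K] b i := fun i => Algebra.TensorProduct.basis_apply _ _
  have heb : ∀ i, e (b i) = Pi.single i 1 := fun i => by simp [b]
  have hb : ∀ i, A.norm (b i) = c i := fun i => by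
    simp [he, heb, Pi.single_apply, ite_pow]
  have hbb : ∀ i j, i ≠ j → A.norm (b i + b j) = c i + c j := fun i j hij => by
    have : ∀ x, c x * e (b i + b j) x ^ 2 =
        (if x = i then c x else 0) + (if x = j then c x else 0) := fun x => by
      rw [map_add, heb, heb, Pi.add_apply, Pi.single_apply, Pi.single_apply]
      split_ifs <;> simp_all
    rw [he, Finset.sum_congr rfl fun x _ => this x, Finset.sum_add_distrib]
    simp
  have hn : ∀ i, (A.baseChange L).norm (b' i) = algebraMap K L (c i) := fun i => by
    exact (congrArg _ (hb' i)).trans ((A.norm_baseChange_tmul L (b i)).trans (by rw [hb]))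
  have hp : ∀ i j, i ≠ j → QuadraticMap.polar (A.baseChange L).norm (b' i) (b' j) = 0 := by
    intro i j hij
    have h : (A.baseChange L).norm (b' i + b' j) = algebraMap K L (c i + c j) := by
      have hadd : b' i + b' j = (1 ⊗ₜ[K] (b i + b j) : L ⊗[K] A.carrier) := by
        rw [TensorProduct.tmul_add]
        exact congrArg₂ (fun x y : L ⊗[K] A.carrier => x + y) (hb' i) (hb' j)
      exact (congrArg _ hadd).trans ((A.norm_baseChange_tmul L (b i + b j)).trans
        (by rw [hbb i j hij]))
    have h' : QuadraticMap.polar (A.baseChange L).norm (b' i) (b' j) =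
        (A.baseChange L).norm (b' i + b' j) - (A.baseChange L).norm (b' i) -
          (A.baseChange L).norm (b' j) := rfl
    rw [h', h, hn, hn, map_add]
    ring
  exact ⟨b'.equivFun, fun x => (A.baseChange L).norm.apply_eq_sum_of_polar_eq_zero b' hn hp x⟩

end ScalarInvolutionAlgebra

/-! ### Formally real polynomial rings and fraction fields. -/

namespace IsFormallyReal

theorem eq_zero_of_sum_sq_eq_zero {R ι : Type*} [CommRing R] [IsFormallyReal R] [Fintype ι]
    {f : ι → R} (h : ∑ i, f i ^ 2 = 0) (i : ι) : f i = 0 := by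
  classical
  rw [← Finset.add_sum_erase _ _ (Finset.mem_univ i)] at h
  have h' := eq_zero_of_add_right (by rw [sq]; exact .mul_self _) (IsSumSq.sum_sq _ _) h
  exact pow_eq_zero_iff two_ne_zero |>.1 h'

/-- Gives access to characteristic zero, so that fields are infinite and polynomials vanishing at
all points are zero. -/
theorem isSemireal {R : Type*} [CommRing R] [Nontrivial R] [IsFormallyReal R] : IsSemireal R where
  one_add_ne_zero hs h := one_ne_zero (eq_zero_of_add_right .one hs h)

instance mvPolynomial (K σ : Type*) [Field K] [IsFormallyReal K] :
    IsFormallyReal (MvPolynomial σ K) := by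
  apply of_eq_zero_of_eq_zero_of_mul_self_add
  intro s a hs h
  have : IsSemireal K := isSemireal
  apply MvPolynomial.funext
  intro x
  have h' := congrArg (MvPolynomial.eval x) h
  rw [map_add, map_mul, map_zero] at h'
  have hs' : IsSumSq (MvPolynomial.eval x s) := by
    clear h h'
    induction hs with
    | zero => simp
    | sq_add b _ ih => rw [map_add, map_mul]; exact .sq_add _ ih
  rw [map_zero]
  exact mul_self_eq_zero.1 (eq_zero_of_add_right (.mul_self _) hs' h')

/-- A sum of squares in `F` becomes a sum of squares in `R` after multiplication by the square of a
common denominator. -/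
theorem of_isFractionRing (R F : Type*) [CommRing R] [IsDomain R] [IsFormallyReal R] [Field F]
    [Algebra R F] [IsFractionRing R F] : IsFormallyReal F := by
  have key : ∀ s : F, IsSumSq s → ∃ d : R, d ≠ 0 ∧ ∃ n : R, IsSumSq n ∧
      s * algebraMap R F d ^ 2 = algebraMap R F n := by
    intro s hs
    induction hs with
    | zero => exact ⟨1, one_ne_zero, 0, .zero, by simp⟩
    | @sq_add a s hs ih =>
      obtain ⟨d, hd, n, hn, h⟩ := ih
      obtain ⟨p, q, hq, rfl⟩ := IsFractionRing.div_surjective (A := R) a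
      have hq' : q ≠ 0 := nonZeroDivisors.ne_zero hq
      have hqF : algebraMap R F q ≠ 0 := by simpa using hq'
      refine ⟨d * q, mul_ne_zero hd hq', (p * d) * (p * d) + q * q * n,
        .sq_add _ (.mul (.mul_self _) hn), ?_⟩
      simp only [map_add, map_mul, ← h]
      field_simp
  apply of_eq_zero_of_eq_zero_of_mul_self_add
  intro s a hs h
  obtain ⟨d, hd, n, hn, h1⟩ := key s hs
  obtain ⟨p, q, hq, rfl⟩ := IsFractionRing.div_surjective (A := R) a
  have hq' : q ≠ 0 := nonZeroDivisors.ne_zero hq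
  have hqF : algebraMap R F q ≠ 0 := by simpa using hq'
  have h2 : (p * d) * (p * d) + q * q * n = 0 := by
    apply IsFractionRing.injective R F
    simp only [map_add, map_mul, ← h1, map_zero]
    have : s = -(algebraMap R F p / algebraMap R F q * (algebraMap R F p / algebraMap R F q)) :=
      eq_neg_of_add_eq_zero_right h
    rw [this]
    field_simp
    ring
  have h3 := mul_self_eq_zero.1
    (eq_zero_of_add_right (.mul_self _) (.mul (.mul_self _) hn) h2)
  have h4 : p = 0 := (mul_eq_zero.1 h3).resolve_right hd
  simp [h4]

instance rationalField (K₀ : Type u) [Field K₀] [IsFormallyReal K₀] (t : ℕ) :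
    IsFormallyReal (RationalField K₀ t) :=
  of_isFractionRing (MvPolynomial (Fin t) K₀) _

end IsFormallyReal

/-! ### Anisotropy over function fields of quadratic forms. -/

open Polynomial in
/-- The leading coefficient of `v²X² - c` is a square, so over a formally real field a sum of
squares stays anisotropic after tensoring with `⟨1, v²X² - c⟩`. -/
theorem Polynomial.eq_zero_of_sum_sq_sub_mul_sq {F ι : Type*} [Field F] [IsFormallyReal F]
    [Fintype ι] {v : F} (hv : v ≠ 0) (c : F) {A B : ι → F[X]}
    (h : ∑ i, (A i ^ 2 - (C c - C (v ^ 2) * X ^ 2) * B i ^ 2) = 0) (i : ι) :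
    A i = 0 ∧ B i = 0 := by
  -- The bounds are `deg Aᵢ ≤ m` and `deg Bᵢ < m`; the shift by one balances the factor `X²` in
  -- front of `Bᵢ²`.
  have key : ∀ m : ℕ, (∀ i n, m + 1 ≤ n → (A i).coeff n = 0) →
      (∀ i n, m ≤ n → (B i).coeff n = 0) → ∀ i, A i = 0 ∧ B i = 0 := by
    intro m
    induction m with
    | zero =>
      intro hA hB i
      have hB0 : ∀ i, B i = 0 := fun i => by ext n; exact hB i n n.zero_le
      simp only [hB0] at h ⊢
      have hA0 : ∀ i, A i = C ((A i).coeff 0) := fun i =>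
        eq_C_of_natDegree_le_zero (natDegree_le_iff_coeff_eq_zero.2 fun n hn => hA i n hn)
      have h0 : ∑ i, (A i).coeff 0 ^ 2 = 0 := by
        have := congrArg (eval 0) h
        simpa [eval_finsetSum, coeff_zero_eq_eval_zero] using this
      rw [hA0 i, IsFormallyReal.eq_zero_of_sum_sq_eq_zero h0 i]
      simp
    | succ m ih =>
      intro hA hB
      have hA' : ∀ i, (A i).natDegree ≤ m + 1 := fun i =>
        natDegree_le_iff_coeff_eq_zero.2 fun n hn => hA i n hn
      have hB' : ∀ i, (B i).natDegree ≤ m := fun i =>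
        natDegree_le_iff_coeff_eq_zero.2 fun n hn => hB i n hn
      have hcoeff : ∀ i, (A i ^ 2 - (C c - C (v ^ 2) * X ^ 2) * B i ^ 2).coeff (2 * (m + 1)) =
          (A i).coeff (m + 1) ^ 2 + (v * (B i).coeff m) ^ 2 := by
        intro i
        have h1 : (A i ^ 2).coeff (2 * (m + 1)) = (A i).coeff (m + 1) ^ 2 :=
          coeff_pow_of_natDegree_le (hA' i)
        have h2 : (X ^ 2 * B i ^ 2).coeff (2 * (m + 1)) = (B i).coeff m ^ 2 := by
          rw [show 2 * (m + 1) = 2 * m + 2 by ring, coeff_X_pow_mul]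
          exact coeff_pow_of_natDegree_le (hB' i)
        have h3 : (B i ^ 2).coeff (2 * (m + 1)) = 0 :=
          coeff_eq_zero_of_natDegree_lt (lt_of_le_of_lt (natDegree_pow_le_of_le 2 (hB' i))
            (by omega))
        rw [coeff_sub, sub_mul, coeff_sub, mul_assoc, coeff_C_mul, coeff_C_mul, h1, h2, h3]
        ring
      have hs := congrArg (fun p => coeff p (2 * (m + 1))) h
      simp only [finsetSum_coeff, hcoeff, coeff_zero, Finset.sum_add_distrib] at hs
      -- The top coefficient is one sum of squares in both families, so all of its terms vanish
      -- together.
      have hs' : ∑ x : ι ⊕ ι, (Sum.elim (fun i => (A i).coeff (m + 1))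
          (fun i => v * (B i).coeff m) x) ^ 2 = 0 := by
        simpa using hs
      have h0 := IsFormallyReal.eq_zero_of_sum_sq_eq_zero hs'
      apply ih
      · intro i n hn
        rcases hn.eq_or_lt with rfl | hn
        · exact h0 (Sum.inl i)
        · exact hA i n hn
      · intro i n hn
        rcases hn.eq_or_lt with rfl | hn
        · exact (mul_eq_zero.1 (h0 (Sum.inr i))).resolve_left hv
        · exact hB i n hn
  let m := Finset.univ.sup (fun i => (A i).natDegree ⊔ ((B i).natDegree + 1))
  have hm : ∀ i, (A i).natDegree ⊔ ((B i).natDegree + 1) ≤ m := fun i =>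
    Finset.le_sup (f := fun i => (A i).natDegree ⊔ ((B i).natDegree + 1)) (Finset.mem_univ i)
  refine key m (fun i n hn => ?_) (fun i n hn => ?_) i
  · exact coeff_eq_zero_of_natDegree_lt (by have := hm i; omega)
  · exact coeff_eq_zero_of_natDegree_lt (by have := hm i; omega)

-- Modulo `X² + g` each `pᵢ` is `Bᵢ X + Aᵢ`. Since `X² = -g`, the two sums in `H` are, up to the
-- factor 2 on the second, the constant and linear coefficients of the remainder of `∑ cᵢ pᵢ²`.
open Polynomial in
theorem Polynomial.dvd_of_dvd_sum_mul_sq {R ι : Type*} [CommRing R] [IsDomain R]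
    (h2 : (2 : R) ≠ 0) [Fintype ι] (c : ι → R) (g : R)
    (H : ∀ A B : ι → R, ∑ i, c i * (A i ^ 2 - g * B i ^ 2) = 0 → ∑ i, c i * (A i * B i) = 0 →
      ∀ i, A i = 0 ∧ B i = 0)
    (p : ι → R[X]) (hp : X ^ 2 + C g ∣ ∑ i, C (c i) * p i ^ 2) (i : ι) : X ^ 2 + C g ∣ p i := by
  have hm : (X ^ 2 + C g).Monic := by monicity!
  have hdeg : (X ^ 2 + C g).degree = 2 := by compute_degree!
  have hr : ∀ i, ∃ A B : R, p i %ₘ (X ^ 2 + C g) = C B * X + C A := fun i => by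
    have h := degree_modByMonic_lt (p i) hm
    rw [hdeg] at h
    exact ⟨_, _, eq_X_add_C_of_degree_le_one (Order.le_of_lt_succ h)⟩
  choose A B hAB using hr
  have hpi : ∀ i, p i = C (B i) * X + C (A i) + (X ^ 2 + C g) * (p i /ₘ (X ^ 2 + C g)) :=
    fun i => by rw [← hAB, modByMonic_add_div]
  have hsum : ∑ i, C (c i) * p i ^ 2 =
      C (2 * ∑ i, c i * (A i * B i)) * X + C (∑ i, c i * (A i ^ 2 - g * B i ^ 2)) +
        (X ^ 2 + C g) * ∑ i, C (c i) * (C (B i) ^ 2 + 2 * (C (B i) * X + C (A i)) *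
          (p i /ₘ (X ^ 2 + C g)) + (X ^ 2 + C g) * (p i /ₘ (X ^ 2 + C g)) ^ 2) := by
    simp only [map_mul, map_sum, Finset.mul_sum, Finset.sum_mul, ← Finset.sum_add_distrib]
    refine Finset.sum_congr rfl fun i _ => ?_
    conv_lhs => rw [hpi i]
    simp only [map_sub, map_mul, map_pow, map_ofNat]
    ring
  rw [hsum, dvd_add_left (dvd_mul_right _ _)] at hp
  have h0 := eq_zero_of_dvd_of_degree_lt hp
    (lt_of_le_of_lt degree_linear_le (by rw [hdeg]; exact WithBot.coe_lt_coe.2 one_lt_two))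
  have hA := congrArg (fun q => coeff q 0) h0
  have hB := congrArg (fun q => coeff q 1) h0
  simp only [coeff_add, coeff_C_mul, coeff_X_zero, coeff_X_one, coeff_C_zero, mul_zero, zero_add,
    coeff_zero, mul_one, coeff_C_succ, add_zero] at hA hB
  have hAB0 := H A B hA ((mul_eq_zero.1 hB).resolve_left h2) i
  rw [hpi i, hAB0.1, hAB0.2]
  simp

namespace MvPolynomial

/-- If `aᵢ = 1`, the polynomial of `⟨a⟩` is monic quadratic in `Xᵢ` over the ring of polynomials in
the other variables. -/
theorem exists_algEquiv_diagonalPolynomial {K : Type u} [Field K] {ι : Type} [Fintype ι]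
    (a : ι → K) {i : ι} (hi : a i = 1) [Fintype {x // x ≠ i}] :
    ∃ e : MvPolynomial ι K ≃ₐ[K] Polynomial (MvPolynomial {x // x ≠ i} K),
      e (diagonalPolynomial a) =
        Polynomial.X ^ 2 + Polynomial.C (diagonalPolynomial fun x : {x // x ≠ i} => a x) := by
  classical
  let e := (renameEquiv K (Equiv.optionSubtypeNe i).symm).trans (optionEquivLeft K {x // x ≠ i})
  refine ⟨e, ?_⟩
  have h1 : e (X i) = Polynomial.X := by
    simp [e, optionEquivLeft_apply]
  have h2 : ∀ x : {x // x ≠ i}, e (X x.1) = Polynomial.C (X x) := by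
    intro x
    simp [e, optionEquivLeft_apply, Equiv.optionSubtypeNe_symm_apply, x.2]
  have h3 : ∀ c : K, e (C c) = Polynomial.C (C c) := by
    intro c
    simp [e, optionEquivLeft_apply]
  have h4 : diagonalPolynomial a = X i ^ 2 + ∑ x : {x // x ≠ i}, C (a x) * X x.1 ^ 2 := by
    rw [diagonalPolynomial, Fintype.sum_eq_add_sum_subtype_ne _ i, hi, map_one, one_mul]
    congr!
  rw [h4, map_add, map_pow, h1, map_sum]
  simp only [diagonalPolynomial, map_sum, map_mul, map_pow, h2, h3]

end MvPolynomial

theorem DiagonalFunctionField.eq_zero_of_sum_mul_sq_eq_zero {K : Type u} [Field K]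
    (hK : (2 : K) ≠ 0) {ι : Type} [Fintype ι] (a : ι → K) {i : ι} (hi : a i = 1)
    [Fintype {x // x ≠ i}] [(Ideal.span {diagonalPolynomial a}).IsPrime]
    {σ : Type*} [Fintype σ] (c : σ → K)
    (H : ∀ A B : σ → MvPolynomial {x // x ≠ i} K,
      ∑ s, MvPolynomial.C (c s) *
        (A s ^ 2 - diagonalPolynomial (fun x : {x // x ≠ i} => a x) * B s ^ 2) = 0 →
      ∑ s, MvPolynomial.C (c s) * (A s * B s) = 0 → ∀ s, A s = 0 ∧ B s = 0)
    (x : σ → DiagonalFunctionField a)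
    (hx : ∑ s, algebraMap K (DiagonalFunctionField a) (c s) * x s ^ 2 = 0) (s : σ) : x s = 0 := by
  let Q := MvPolynomial ι K ⧸ Ideal.span {diagonalPolynomial a}
  obtain ⟨b, hb⟩ := IsLocalization.exist_integer_multiples_of_finite (nonZeroDivisors Q) x
  have hb0 : algebraMap Q (DiagonalFunctionField a) b ≠ 0 := by
    simp
  choose q hq using hb
  choose p hp using fun s => Ideal.Quotient.mk_surjective (q s)
  obtain ⟨e, he⟩ := MvPolynomial.exists_algEquiv_diagonalPolynomial a hi
  have hC : ∀ k : K, e (MvPolynomial.C k) = Polynomial.C (MvPolynomial.C k) := fun k =>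
    e.commutes k
  have hsum : ∑ s, MvPolynomial.C (c s) * p s ^ 2 ∈ Ideal.span {diagonalPolynomial a} := by
    rw [← Ideal.Quotient.eq_zero_iff_mem]
    apply IsFractionRing.injective Q (DiagonalFunctionField a)
    have hc : ∀ k : K, algebraMap Q (DiagonalFunctionField a)
        (Ideal.Quotient.mk _ (MvPolynomial.C k)) = algebraMap K (DiagonalFunctionField a) k :=
      fun k => rfl
    rw [map_zero, map_sum, map_sum, ← mul_zero (algebraMap Q (DiagonalFunctionField a) b ^ 2),
      ← hx, Finset.mul_sum]
    refine Finset.sum_congr rfl fun s _ => ?_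
    rw [map_mul, map_mul, hc, map_pow, map_pow, hp, hq, Algebra.smul_def]
    ring
  rw [Ideal.mem_span_singleton, ← map_dvd_iff e, he, map_sum] at hsum
  simp only [map_mul, map_pow, hC] at hsum
  have hs := Polynomial.dvd_of_dvd_sum_mul_sq (by
    rw [← map_ofNat MvPolynomial.C 2]
    simpa using hK) _ _ H _ hsum s
  rw [← he, map_dvd_iff, ← Ideal.mem_span_singleton, ← Ideal.Quotient.eq_zero_iff_mem, hp] at hs
  have := hq s
  rw [hs, map_zero, Algebra.smul_def] at this
  exact (mul_eq_zero.1 this.symm).resolve_left hb0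

/-- If the weights become squares, and some coefficient of `g` becomes the negative of a square,
in a formally real field, then the weighted form stays anisotropic after twisting by `⟨1, -g⟩`. -/
theorem MvPolynomial.eq_zero_of_sum_mul_sq_sub_mul_sq {K F : Type*} [Field K] [Field F]
    [IsFormallyReal F] (ψ : K →+* F) {ι σ : Type*} [Fintype ι] [Fintype σ] (a : ι → K) (c : σ → K)
    (u : σ → F) (hu : ∀ s, u s ≠ 0) (hc : ∀ s, ψ (c s) = u s ^ 2) {j : ι} {v : F} (hv : v ≠ 0)
    (hj : ψ (a j) = -v ^ 2) (A B : σ → MvPolynomial ι K)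
    (h : ∑ s, C (c s) * (A s ^ 2 - (∑ i, C (a i) * X i ^ 2) * B s ^ 2) = 0) (s : σ) :
    A s = 0 ∧ B s = 0 := by
  classical
  have : IsSemireal F := IsFormallyReal.isSemireal
  have key : ∀ y : ι → F, eval y (map ψ (A s)) = 0 ∧ eval y (map ψ (B s)) = 0 := by
    intro y
    -- Specialise every variable except the `j`-th, which becomes the variable of `F[X]`.
    let f : MvPolynomial ι K →+* Polynomial F :=
      eval₂Hom (Polynomial.C.comp ψ) fun i => if i = j then Polynomial.X else Polynomial.C (y i)
    have hf : ∀ p, Polynomial.eval (y j) (f p) = eval y (map ψ p) := by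
      have : ((Polynomial.evalRingHom (y j)).comp f) = (eval y).comp (map ψ) := by
        apply ringHom_ext
        · intro r; simp [f]
        · intro i
          by_cases hi : i = j <;> simp [f, hi]
      exact fun p => congrArg (fun g => g p) this
    have hg : f (∑ i, C (a i) * X i ^ 2) =
        Polynomial.C (∑ i ∈ Finset.univ.erase j, ψ (a i) * y i ^ 2) -
          Polynomial.C (v ^ 2) * Polynomial.X ^ 2 := by
      rw [← Finset.add_sum_erase _ _ (Finset.mem_univ j), map_add, map_sum, map_sum]
      have h1 : f (C (a j) * X j ^ 2) = -(Polynomial.C (v ^ 2) * Polynomial.X ^ 2) := by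
        simp [f, hj]
      rw [h1, neg_add_eq_sub]
      congr 1
      refine Finset.sum_congr rfl fun i hi => ?_
      simp [f, Finset.ne_of_mem_erase hi]
    have h0 : ∑ s, ((Polynomial.C (u s) * f (A s)) ^ 2 -
        (Polynomial.C (∑ i ∈ Finset.univ.erase j, ψ (a i) * y i ^ 2) -
          Polynomial.C (v ^ 2) * Polynomial.X ^ 2) * (Polynomial.C (u s) * f (B s)) ^ 2) = 0 := by
      rw [← hg, ← (map_sum f _ _).symm.trans ((congrArg f h).trans (map_zero f))]
      refine Finset.sum_congr rfl fun s _ => ?_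
      have : f (C (c s)) = Polynomial.C (u s) ^ 2 := by simp [f, hc]
      simp only [map_mul, map_sub, map_pow, this]
      ring
    have hs := Polynomial.eq_zero_of_sum_sq_sub_mul_sq hv _ h0 s
    rw [mul_eq_zero, mul_eq_zero] at hs
    have hus : Polynomial.C (u s) ≠ 0 := by simpa using hu s
    rw [← hf, ← hf, hs.1.resolve_left hus, hs.2.resolve_left hus]
    simp
  constructor
  · exact map_injective ψ ψ.injective (by rw [map_zero]; exact funext fun y => by simp [key])
  · exact map_injective ψ ψ.injective (by rw [map_zero]; exact funext fun y => by simp [key])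

/-- A form which stays anisotropic in an extension containing `√-1` stays anisotropic over the
function field of `⟨1, 1⟩`. -/
theorem MvPolynomial.eq_zero_of_sum_mul_sq_of_sq {K F : Type*} [Field K] [Field F] [Infinite K]
    (hF : (2 : F) ≠ 0) (ψ : K →+* F) {z : F} (hz : z ^ 2 = -1) {ι σ : Type*} [Fintype σ]
    (c : σ → K) (hc : ∀ w : σ → F, ∑ s, ψ (c s) * w s ^ 2 = 0 → ∀ s, w s = 0)
    {g h : MvPolynomial ι K} (hg : g = h ^ 2) (hh : h ≠ 0) (A B : σ → MvPolynomial ι K)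
    (h1 : ∑ s, C (c s) * (A s ^ 2 - g * B s ^ 2) = 0) (h2 : ∑ s, C (c s) * (A s * B s) = 0)
    (s : σ) : A s = 0 ∧ B s = 0 := by
  have key : ∀ y : ι → K, eval y (A s) = 0 ∧ eval y (h * B s) = 0 := by
    intro y
    let f := ψ.comp (eval y)
    have hfc : ∀ k, f (C k) = ψ k := fun k => by simp [f]
    have e1 := congrArg f h1
    have e2 := congrArg f h2
    simp only [hg, map_sum, map_mul, map_sub, map_pow, map_zero, hfc] at e1 e2
    -- Expanding the form at `A + ε h B` gives the first equation plus a multiple of the second.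
    -- Taking `ε = ±z` then separates `A` from `h B`.
    have hadd : ∀ ε : F, ε ^ 2 = -1 → f (A s) + ε * (f h * f (B s)) = 0 := by
      intro ε hε
      refine hc (fun s => f (A s) + ε * (f h * f (B s))) ?_ s
      calc ∑ s, ψ (c s) * (f (A s) + ε * (f h * f (B s))) ^ 2
          = ∑ s, ψ (c s) * (f (A s) ^ 2 - f h ^ 2 * f (B s) ^ 2) +
              2 * ε * f h * ∑ s, ψ (c s) * (f (A s) * f (B s)) := by
            rw [Finset.mul_sum, ← Finset.sum_add_distrib]
            refine Finset.sum_congr rfl fun s _ => ?_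
            linear_combination ψ (c s) * (f h * f (B s)) ^ 2 * hε
        _ = 0 := by rw [e1, e2]; ring
    have p := hadd z hz
    have q := hadd (-z) (by rw [neg_sq, hz])
    have hz0 : z ≠ 0 := by rintro rfl; simp at hz
    have hA : f (A s) = 0 := by
      refine (mul_eq_zero.1 (?_ : 2 * f (A s) = 0)).resolve_left hF
      linear_combination p + q
    have hB : f (h * B s) = 0 := by
      rw [map_mul]
      refine (mul_eq_zero.1 (?_ : z * (f h * f (B s)) = 0)).resolve_left hz0
      linear_combination p - hA
    exact ⟨(map_eq_zero ψ).1 hA, (map_eq_zero ψ).1 hB⟩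
  constructor
  · exact funext fun y => by simpa using (key y).1
  · exact (mul_eq_zero.1 (funext fun y => by simpa using (key y).2 : h * B s = 0)).resolve_left hh

/-- With pairwise distinct leading exponents, the largest leading term cannot be cancelled. -/
theorem MonomialOrder.eq_zero_of_sum_eq_zero {σ R ι : Type*} [CommRing R] (m : MonomialOrder σ)
    [Fintype ι] (f : ι → MvPolynomial σ R)
    (hf : ∀ i j, f i ≠ 0 → f j ≠ 0 → m.degree (f i) = m.degree (f j) → i = j)
    (h : ∑ i, f i = 0) (i : ι) : f i = 0 := by
  classical
  by_contra hi
  obtain ⟨j, hj, hmax⟩ := Finset.exists_max_image (Finset.univ.filter fun j => f j ≠ 0)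
    (fun j => m.toSyn (m.degree (f j))) ⟨i, by simpa using hi⟩
  have hj0 : f j ≠ 0 := by simpa using hj
  have hc := congrArg (MvPolynomial.coeff (m.degree (f j))) h
  rw [MvPolynomial.coeff_sum, MvPolynomial.coeff_zero, Finset.sum_eq_single j] at hc
  · exact m.coeff_degree_ne_zero_iff.2 hj0 hc
  · intro k _ hkj
    by_cases hk : f k = 0
    · simp [hk]
    · refine m.coeff_eq_zero_of_lt (lt_of_le_of_ne (hmax k (by simpa using hk)) fun he => hkj ?_)
      exact hf k j hk hj0 (m.toSyn.injective he)
  · simp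

/-! ### The generic norm form and homomorphisms of rational function fields. -/

namespace RationalField

variable (K₀ : Type u) [Field K₀] {t : ℕ}

open ScalarInvolutionAlgebra

theorem indeterminate_ne_zero (i : Fin t) : indeterminate K₀ t i ≠ 0 := by
  simp [indeterminate]

/-- The norm form of the generic Cayley–Dickson process is anisotropic. -/
theorem eq_zero_of_sum_normCoeff_mul_sq (w : (Fin t → Bool) → RationalField K₀ t)
    (h : ∑ s, normCoeff (indeterminate K₀ t) s * w s ^ 2 = 0) (s : Fin t → Bool) : w s = 0 := by
  let R := MvPolynomial (Fin t) K₀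
  let F := RationalField K₀ t
  obtain ⟨b, hb⟩ := IsLocalization.exist_integer_multiples_of_finite (nonZeroDivisors R) w
  have hb0 : algebraMap R F b ≠ 0 := by simp
  choose q hq using hb
  let d : (Fin t → Bool) → Fin t →₀ ℕ := fun s =>
    Finsupp.equivFunOnFinite.symm fun i => if s i then 1 else 0
  let c : (Fin t → Bool) → R := fun s => ∏ i, if s i then -MvPolynomial.X i else 1
  have hc : ∀ s, algebraMap R F (c s) = normCoeff (indeterminate K₀ t) s := fun s => by
    simp only [c, normCoeff, map_prod]
    refine Finset.prod_congr rfl fun i _ => ?_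
    split_ifs <;> simp [indeterminate, F, R]
  have hcm : ∀ s, ∃ ε : K₀, ε ≠ 0 ∧ c s = MvPolynomial.monomial (d s) ε := fun s => by
    refine ⟨∏ i, if s i then -1 else 1, ?_, ?_⟩
    · refine Finset.prod_ne_zero_iff.2 fun i _ => ?_
      split_ifs <;> simp
    · rw [MvPolynomial.monomial_eq, Finsupp.prod_fintype _ _ (by simp), map_prod,
        ← Finset.prod_mul_distrib]
      refine Finset.prod_congr rfl fun i _ => ?_
      by_cases hi : s i <;> simp [d, hi]
  choose ε hε hcε using hcm
  have hc0 : ∀ s, c s ≠ 0 := fun s => by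
    rw [hcε]; exact (MvPolynomial.monomial_eq_zero.not).2 (hε s)
  have hsum : ∑ s, c s * q s ^ 2 = 0 := by
    apply IsFractionRing.injective R F
    rw [map_zero, map_sum, ← mul_zero (algebraMap R F b ^ 2), ← h, Finset.mul_sum]
    refine Finset.sum_congr rfl fun s _ => ?_
    rw [map_mul, hc, map_pow, hq, Algebra.smul_def]
    ring
  let m : MonomialOrder (Fin t) := MonomialOrder.lex
  have hdeg : ∀ s, q s ≠ 0 → m.degree (c s * q s ^ 2) = d s + 2 • m.degree (q s) := fun s hs => by
    classical
    rw [m.degree_mul (hc0 s) (pow_ne_zero 2 hs), m.degree_pow, hcε, m.degree_monomial,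
      if_neg (hε s)]
  -- The leading exponent of `cₛ qₛ²` is the indicator vector of `s` plus an even vector, so its
  -- parity recovers `s`.
  have hq0 := m.eq_zero_of_sum_eq_zero (fun s => c s * q s ^ 2) (fun s s' hs hs' he => by
    rw [hdeg s (by rintro h; simp [h] at hs), hdeg s' (by rintro h; simp [h] at hs')] at he
    ext i
    have hi := DFunLike.congr_fun he i
    simp only [d, Finsupp.add_apply, Finsupp.smul_apply, smul_eq_mul,
      Finsupp.equivFunOnFinite_symm_apply_apply] at hi
    cases h1 : s i <;> cases h2 : s' i <;> simp [h1, h2] at hi ⊢ <;> omega) hsum s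
  have hqs : q s = 0 := by
    simpa using (mul_eq_zero.1 hq0).resolve_left (hc0 s)
  have := hq s
  rw [hqs, map_zero, Algebra.smul_def] at this
  exact (mul_eq_zero.1 this.symm).resolve_left hb0

/-- The endomorphism `Xᵢ ↦ -Xᵢ²`. -/
theorem exists_ringHom_indeterminate_eq_neg_sq (t : ℕ) :
    ∃ ψ : RationalField K₀ t →+* RationalField K₀ t,
      ∀ i, ψ (indeterminate K₀ t i) = -indeterminate K₀ t i ^ 2 := by
  let R := MvPolynomial (Fin t) K₀
  let F := RationalField K₀ t
  -- Independence makes the substitution injective on polynomials, hence extendable to fractions.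
  have hind : AlgebraicIndependent K₀ fun i : Fin t => -(MvPolynomial.X i : R) ^ 2 := by
    have := MvPolynomial.algebraicIndependent_polynomial_aeval_X (R := K₀) (ι := Fin t)
      (fun _ => -Polynomial.X ^ 2) fun _ => by
        intro h
        have h' := h.neg
        rw [neg_neg] at h'
        exact (Polynomial.transcendental_X K₀).pow two_pos h'
    simpa using this
  let f : R →+* F := (algebraMap R F).comp
    (MvPolynomial.aeval fun i : Fin t => -(MvPolynomial.X i : R) ^ 2).toRingHom
  have hf : Function.Injective f := (IsFractionRing.injective R F).comp hind
  refine ⟨IsFractionRing.lift hf, fun i => ?_⟩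
  rw [indeterminate, IsFractionRing.lift_algebraMap]
  simp [f, R, F]

/-- Allows a square root of `-1` to be adjoined to the constants while the `Xᵢ` stay independent. -/
theorem exists_ringHom_of_field {E : Type u} [Field E] (φ : K₀ →+* E) (t : ℕ) :
    ∃ ψ : RationalField K₀ t →+* RationalField E t,
      ∀ i, ψ (indeterminate K₀ t i) = indeterminate E t i := by
  let f : MvPolynomial (Fin t) K₀ →+* RationalField E t :=
    (algebraMap (MvPolynomial (Fin t) E) (RationalField E t)).comp (MvPolynomial.map φ)
  have hf : Function.Injective f :=
    (IsFractionRing.injective _ _).comp (MvPolynomial.map_injective φ φ.injective)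
  refine ⟨IsFractionRing.lift hf, fun i => ?_⟩
  rw [indeterminate, IsFractionRing.lift_algebraMap]
  simp [f, indeterminate]

end RationalField

theorem ScalarInvolutionAlgebra.map_normCoeff {K F : Type u} [Field K] [Field F] (ψ : K →+* F)
    {t : ℕ} (α : Fin t → K) (s : Fin t → Bool) :
    ψ (normCoeff α s) = normCoeff (fun i => ψ (α i)) s := by
  simp only [normCoeff, map_prod]
  refine Finset.prod_congr rfl fun i _ => ?_
  split_ifs <;> simp

/-! ### The two cases of the main theorem. -/

open ScalarInvolutionAlgebra RationalField in
theorem proposition2p8 {K₀ : Type u} [Field K₀] [IsFormallyReal K₀] (t n k r : ℕ) (ht : 1 ≤ t)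
    (hr : Odd r) (hn : n = 2 ^ k * r) :
    (brownAlgebraPhi K₀ t n k).norm.Anisotropic := by
  classical
  let K := RationalField K₀ t
  have : IsSemireal K₀ := IsFormallyReal.isSemireal
  have : IsSemireal K := IsFormallyReal.isSemireal
  obtain ⟨e, he⟩ := exists_norm_process_eq_sum t (indeterminate K₀ t)
  obtain ⟨e', he'⟩ :=
    (brownAlgebra K₀ t).exists_norm_baseChange_eq_sum _ e he (PhiFunctionField K₀ t n k)
  intro x hx
  have hx' := (he' x).symm.trans hx
  refine (LinearEquiv.map_eq_zero_iff e').1 (funext fun s => ?_)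
  have hk : 0 < 2 ^ k := by positivity
  have hr0 : 0 < r := hr.pos
  let i : Fin (2 ^ k + 1) ⊕ (Fin (n - 1) × {S : Finset (Fin t) // S.Nonempty}) :=
    Sum.inl ⟨0, by omega⟩
  refine DiagonalFunctionField.eq_zero_of_sum_mul_sq_eq_zero two_ne_zero
    (phiCoeff K₀ t (2 ^ k + 1) (n - 1)) (i := i) rfl _ ?_ (e' x) hx' s
  intro A B h1 h2
  by_cases hn1 : n = 1
  · obtain ⟨hk1, hr1⟩ := mul_eq_one.1 (hn.symm.trans hn1)
    obtain rfl : k = 0 := by simpa using hk1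
    subst hn1
    let E := AlgebraicClosure K₀
    let F := RationalField E t
    obtain ⟨ψ, hψ⟩ := exists_ringHom_of_field K₀ (algebraMap K₀ E) t
    obtain ⟨z, hz⟩ := IsAlgClosed.exists_pow_nat_eq (-1 : E) two_pos
    have hF : CharZero F := (RingHom.charZero_iff ψ.injective).1 inferInstance
    let j : {x // x ≠ i} := ⟨Sum.inl ⟨1, by simp⟩, by simp [i]⟩
    -- Here `2 ^ 0 + 1 = 2` and `n - 1 = 0`: one variable remains beside the `i`-th, and `g` is its
    -- square.
    have huniq : ∀ x : {x // x ≠ i}, x = j := by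
      rintro ⟨x | x, hx⟩
      · apply Subtype.ext
        have : x.1 ≠ 0 := fun h => hx (by simp only [i]; congr; exact Fin.ext h)
        simp only [j]
        congr
        apply Fin.ext
        have := x.2
        simp only [pow_zero] at this ⊢
        omega
      · exact (Nat.not_lt_zero _ x.1.2).elim
    refine MvPolynomial.eq_zero_of_sum_mul_sq_of_sq (F := F) two_ne_zero ψ
      (z := algebraMap (MvPolynomial (Fin t) E) F (MvPolynomial.C z))
      (by rw [← map_pow, ← map_pow, hz]; simp) _
      (fun w hw => ?_) (h := MvPolynomial.X j) ?_ (MvPolynomial.X_ne_zero j) A B h1 h2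
    · simp only [map_normCoeff, hψ] at hw
      exact eq_zero_of_sum_normCoeff_mul_sq E w hw
    · rw [diagonalPolynomial, Fintype.sum_eq_single j fun x hx => (hx (huniq x)).elim]
      simp [j, phiCoeff]
  · obtain ⟨ψ, hψ⟩ := exists_ringHom_indeterminate_eq_neg_sq K₀ t
    have hn2 : 0 < n - 1 := by
      have : 0 < n := hn ▸ Nat.mul_pos hk hr0
      omega
    let X := indeterminate K₀ t
    -- Under `ψ` the coefficient of `s` becomes `∏ Xᵢ²` over the `i` with `s i = true`. The index
    -- `j` is the singleton `{1}` in the first copy of `T_P`, with coefficient `X₁ ↦ -X₁²`.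
    refine MvPolynomial.eq_zero_of_sum_mul_sq_sub_mul_sq ψ
      (fun x : {x // x ≠ i} => phiCoeff K₀ t (2 ^ k + 1) (n - 1) x) _
      (fun s => ∏ i, if s i then X i else 1) (fun s => ?_) (fun s => ?_)
      (j := ⟨Sum.inr (⟨0, hn2⟩, ⟨{⟨0, ht⟩}, by simp⟩), by simp [i]⟩)
      (indeterminate_ne_zero K₀ ⟨0, ht⟩) ?_ A B h1
    · refine Finset.prod_ne_zero_iff.2 fun i _ => ?_
      split_ifs
      · exact indeterminate_ne_zero K₀ i
      · exact one_ne_zero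
    · rw [map_normCoeff, normCoeff, ← Finset.prod_pow]
      refine Finset.prod_congr rfl fun i _ => ?_
      split_ifs
      · rw [hψ, neg_neg]
      · simp
    · simp [phiCoeff, pureTraceCoeff, hψ]
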